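/- For $d\in[0,1]$ consider the binary i.i.d. deletion channel with deletion probability $d$: each transmitted bit is deleted with probability $d$ and kept unchanged with probability $1-d$, independently of the other bits, and the receiver sees only the word formed by the surviving bits in their original order. Write $W_d(y\mid x)$ for the probability that the word $y\in\{0,1\}^*$ is received when the word $x\in\{0,1\}^*$ is sent. Its capacity, in bits per channel use, is $$C(d)=\lim_{N\to\infty}\frac1N\sup_{P_X} I(X;Y),$$ where the supremum is over all probability distributions $P_X$ of an input block $X\in\{0,1\}^N$, $Y$ is the corresponding channel output, and $I(X;Y)$ is the mutual information in bits. This limit exists for every $d\in[0,1]$. Let $\lambda\in[0,1]$ and $d_1\in[0,1]$. Then the series concatenation of the deletion channel with deletion probability $1-\lambda$ followed by the deletion channel with deletion probability $d_1$ is the deletion channel with deletion probability $\lambda d_1+1-\lambda$, i.e. $$\sum_{z}W_{1-\lambda}(z\mid x)\,W_{d_1}(y\mid z)=W_{\lambda d_1+1-\lambda}(y\mid x)\qquad\text{for all words } x,y,$$ and $$C(\lambda d_1+1-\lambda)\le\lambda\,C(d_1).$$ -/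

import Mathlib

open Filter Topology

noncomputable section

namespace DeletionChannel

/-- The word that is received when `x` is sent and exactly the bits at the positions `i` with
`keep i = true` survive; the surviving bits keep their order. -/
def received (x : List Bool) (keep : Fin x.length → Bool) : List Bool :=
  ((List.finRange x.length).filter keep).map x.get

/-- Transition probability `W_d(y | x)` of the binary i.i.d. deletion channel: every bit of `x` is
deleted with probability `d` and kept with probability `1 - d`, independently of the others, and
the receiver sees only the word formed by the surviving bits. -/
def transition (d : ℝ) (x y : List Bool) : ℝ :=
  ∑ keep : Fin x.length → Bool,
    if received x keep = y then ∏ i, (if keep i then 1 - d else d) else 0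

/-- The finite set of binary words of length at most `n`, the possible outputs for an input of
`n` bits. -/
def wordsUpTo (n : ℕ) : Finset (List Bool) :=
  (List.finite_length_le Bool n).toFinset

/-- Mutual information, in bits, of a pair of random variables with values in the finite sets `A`
and `B` and joint probability mass function `P`; terms with `P a b = 0` contribute `0`. -/
def mutualInfo {α β : Type*} (A : Finset α) (B : Finset β) (P : α → β → ℝ) : ℝ :=
  ∑ a ∈ A, ∑ b ∈ B,
    P a b * Real.logb 2 (P a b / ((∑ b' ∈ B, P a b') * (∑ a' ∈ A, P a' b)))

/-- `I(X; Y)` when `X` is a block of `n` bits with law `p` and `Y` is the output of the deletion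
channel with deletion probability `d` for the input `X`. -/
def blockInfo (d : ℝ) (n : ℕ) (p : (Fin n → Bool) → ℝ) : ℝ :=
  mutualInfo Finset.univ (wordsUpTo n) (fun x y => p x * transition d (List.ofFn x) y)

/-- The supremum of `I(X; Y)` over all laws of a block `X` of `n` bits. -/
def maxInfo (d : ℝ) (n : ℕ) : ℝ :=
  sSup (blockInfo d n '' stdSimplex ℝ (Fin n → Bool))

/-- The capacity `C(d)`, in bits per channel use: the limiting value of the maximal information
rate `max I(X; Y) / n` as the block length `n` tends to infinity. -/
def capacity (d : ℝ) : ℝ :=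
  limsup (fun n : ℕ => maxInfo d n / n) atTop

end DeletionChannel

end

noncomputable section

namespace DeletionChannel

open Finset

/-! ### Relative entropy and mutual information on finite sets -/

/-! A bit survives both channels with probability λ(1 - d₁), so the series is again a deletion
channel. For the capacity bound, reveal to the receiver which bits the first channel deleted. Given
this pattern `k`, what remains is the second channel fed with the m bits that survive, so the
information is at most `maxInfo d₁ m`. No side-information variable is needed: the composite channel
is the mixture over `k` of these channels, and mutual information is convex in the channel
(`mutualInfo_sum_le`). This gives `maxInfo_comp_le`. The number m has mean λn, and for each c >
C(d₁) there is an affine bound `maxInfo d₁ m ≤ c * m + a`. Averaging, dividing by n and letting c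
decrease to C(d₁) gives the claim.

The limit defining C(d) exists by Fekete's lemma. Subadditivity (`maxInfo_add_le`) comes from
revealing where the output of the first block ends: the true output is a function, concatenation, of
the pair of block outputs. Convexity, data processing and nonnegativity all rest on
`log_sum_inequality`. -/

/-- Relative entropy, in bits, of `P` with respect to `Q` on a finite set. -/
def relEnt {β : Type*} (B : Finset β) (P Q : β → ℝ) : ℝ :=
  ∑ b ∈ B, P b * Real.logb 2 (P b / Q b)

/-- Bound the logarithm by 1 - 1/t ≤ log t at t = (a i / b i) / (A / B); the correction terms cancel
when summed over `i`. -/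
theorem log_sum_inequality {ι : Type*} (s : Finset ι) (a b : ι → ℝ)
    (ha : ∀ i ∈ s, 0 ≤ a i) (hb : ∀ i ∈ s, 0 ≤ b i) (hab : ∀ i ∈ s, b i = 0 → a i = 0) :
    (∑ i ∈ s, a i) * Real.logb 2 ((∑ i ∈ s, a i) / ∑ i ∈ s, b i) ≤
      ∑ i ∈ s, a i * Real.logb 2 (a i / b i) := by
  set A := ∑ i ∈ s, a i with hA
  set B := ∑ i ∈ s, b i with hB
  rcases (sum_nonneg ha).eq_or_lt with h0 | hpos
  · rw [← hA] at h0
    have hz : ∀ i ∈ s, a i = 0 := (sum_eq_zero_iff_of_nonneg ha).1 (hA ▸ h0.symm)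
    rw [← h0, zero_mul, sum_eq_zero fun i hi => by rw [hz i hi, zero_mul]]
  rw [← hA] at hpos
  have hBpos : 0 < B := by
    refine lt_of_le_of_ne (sum_nonneg hb) fun h => hpos.ne' ?_
    have hz := (sum_eq_zero_iff_of_nonneg hb).1 (hB ▸ h.symm)
    exact sum_eq_zero fun i hi => hab i hi (hz i hi)
  have key : ∀ i ∈ s, a i * Real.log (A / B) + (a i - b i * (A / B)) ≤
      a i * Real.log (a i / b i) := by
    intro i hi
    rcases (ha i hi).eq_or_lt with h | h
    · have := mul_nonneg (hb i hi) (div_pos hpos hBpos).le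
      simp only [← h, zero_mul]
      linarith
    · have hbi : 0 < b i := lt_of_le_of_ne (hb i hi) fun h' => h.ne' (hab i hi h'.symm)
      have h1 := Real.one_sub_inv_le_log_of_pos (x := (a i / b i) / (A / B)) (by positivity)
      rw [Real.log_div (by positivity) (by positivity)] at h1
      have h2 := mul_le_mul_of_nonneg_left h1 h.le
      have h3 : a i * (1 - ((a i / b i) / (A / B))⁻¹) = a i - b i * (A / B) := by
        field_simp
      rw [h3] at h2
      linarith
  have hsum := sum_le_sum key
  rw [sum_add_distrib, sum_sub_distrib, ← sum_mul, ← sum_mul, ← hA, ← hB,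
    mul_div_cancel₀ A hBpos.ne', sub_self, add_zero] at hsum
  have h2 : 0 < Real.log 2 := Real.log_pos (by norm_num)
  simp only [Real.logb, ← mul_div_assoc, ← sum_div]
  gcongr

theorem relEnt_nonneg {β : Type*} (B : Finset β) (P Q : β → ℝ)
    (hP : ∀ b ∈ B, 0 ≤ P b) (hQ : ∀ b ∈ B, 0 ≤ Q b) (hPQ : ∀ b ∈ B, Q b = 0 → P b = 0)
    (hP1 : ∑ b ∈ B, P b = 1) (hQ1 : ∑ b ∈ B, Q b = 1) : 0 ≤ relEnt B P Q := by
  have h := log_sum_inequality B P Q hP hQ hPQ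
  rwa [hP1, hQ1, div_one, Real.logb_one, mul_zero] at h

theorem mul_logb_mul_div_mul (c a b : ℝ) :
    c * a * Real.logb 2 (c * a / (c * b)) = c * (a * Real.logb 2 (a / b)) := by
  rcases eq_or_ne c 0 with rfl | hc
  · simp
  · rw [mul_div_mul_left _ _ hc, mul_assoc]

/-- Joint convexity of relative entropy. -/
theorem relEnt_sum_le {ι β : Type*} (s : Finset ι) (B : Finset β) (w : ι → ℝ) (P Q : ι → β → ℝ)
    (hw : ∀ i ∈ s, 0 ≤ w i) (hP : ∀ i ∈ s, ∀ b ∈ B, 0 ≤ P i b) (hQ : ∀ i ∈ s, ∀ b ∈ B, 0 ≤ Q i b)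
    (hPQ : ∀ i ∈ s, ∀ b ∈ B, Q i b = 0 → P i b = 0) :
    relEnt B (fun b => ∑ i ∈ s, w i * P i b) (fun b => ∑ i ∈ s, w i * Q i b) ≤
      ∑ i ∈ s, w i * relEnt B (P i) (Q i) := by
  simp only [relEnt, mul_sum]
  rw [sum_comm]
  refine sum_le_sum fun b hb => ?_
  refine (log_sum_inequality s (fun i => w i * P i b) (fun i => w i * Q i b)
    (fun i hi => mul_nonneg (hw i hi) (hP i hi b hb))
    (fun i hi => mul_nonneg (hw i hi) (hQ i hi b hb)) fun i hi h => ?_).trans_eq ?_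
  · rcases mul_eq_zero.1 h with h | h
    · rw [h, zero_mul]
    · rw [hPQ i hi b hb h, mul_zero]
  · exact sum_congr rfl fun i _ => mul_logb_mul_div_mul _ _ _

/-- Data processing for relative entropy. -/
theorem relEnt_map_le {ι β : Type*} [DecidableEq β] (s : Finset ι) (B : Finset β) (f : ι → β)
    (hf : ∀ i ∈ s, f i ∈ B) (P Q : ι → ℝ) (hP : ∀ i ∈ s, 0 ≤ P i) (hQ : ∀ i ∈ s, 0 ≤ Q i)
    (hPQ : ∀ i ∈ s, Q i = 0 → P i = 0) :
    relEnt B (fun b => ∑ i ∈ s with f i = b, P i) (fun b => ∑ i ∈ s with f i = b, Q i) ≤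
      relEnt s P Q := by
  rw [relEnt, relEnt, ← sum_fiberwise_of_maps_to hf]
  refine sum_le_sum fun b _ => ?_
  exact log_sum_inequality _ _ _ (fun i hi => hP i (mem_filter.1 hi).1)
    (fun i hi => hQ i (mem_filter.1 hi).1) fun i hi => hPQ i (mem_filter.1 hi).1

theorem relEnt_prod {β γ : Type*} (B : Finset β) (C : Finset γ) (P Q : β → ℝ) (P' Q' : γ → ℝ)
    (hP1 : ∑ b ∈ B, P b = 1) (hP1' : ∑ c ∈ C, P' c = 1)
    (hPQ : ∀ b ∈ B, Q b = 0 → P b = 0) (hPQ' : ∀ c ∈ C, Q' c = 0 → P' c = 0) :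
    relEnt (B ×ˢ C) (fun i => P i.1 * P' i.2) (fun i => Q i.1 * Q' i.2) =
      relEnt B P Q + relEnt C P' Q' := by
  have key : ∀ b ∈ B, ∀ c ∈ C, P b * P' c * Real.logb 2 (P b * P' c / (Q b * Q' c)) =
      P b * Real.logb 2 (P b / Q b) * P' c + P b * (P' c * Real.logb 2 (P' c / Q' c)) := by
    intro b hb c hc
    by_cases h : P b = 0
    · simp [h]
    by_cases h' : P' c = 0
    · simp [h']
    have hQ := mt (hPQ b hb) h
    have hQ' := mt (hPQ' c hc) h'
    rw [mul_div_mul_comm, Real.logb_mul (div_ne_zero h hQ) (div_ne_zero h' hQ')]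
    ring
  rw [relEnt, sum_product, sum_congr rfl fun b hb => sum_congr rfl (key b hb)]
  simp only [sum_add_distrib, ← mul_sum, ← sum_mul, hP1', hP1, mul_one, one_mul]
  rfl

/-! ### Mutual information of a finite channel -/

/-- The law of the output of the channel `W` for an input with law `p`. -/
def outputLaw {α β : Type*} (A : Finset α) (p : α → ℝ) (W : α → β → ℝ) (b : β) : ℝ :=
  ∑ a ∈ A, p a * W a b

section channel

variable {α β : Type*} {A : Finset α} {B : Finset β} {p : α → ℝ} {W : α → β → ℝ}

theorem outputLaw_nonneg (hp : ∀ a ∈ A, 0 ≤ p a) (hW : ∀ a ∈ A, ∀ b ∈ B, 0 ≤ W a b) :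
    ∀ b ∈ B, 0 ≤ outputLaw A p W b :=
  fun b hb => sum_nonneg fun a ha => mul_nonneg (hp a ha) (hW a ha b hb)

theorem sum_outputLaw (hp1 : ∑ a ∈ A, p a = 1) (hW1 : ∀ a ∈ A, ∑ b ∈ B, W a b = 1) :
    ∑ b ∈ B, outputLaw A p W b = 1 := by
  simp only [outputLaw]
  rw [sum_comm, ← hp1]
  exact sum_congr rfl fun a ha => by rw [← mul_sum, hW1 a ha, mul_one]

theorem mul_eq_zero_of_outputLaw_eq_zero (hp : ∀ a ∈ A, 0 ≤ p a)
    (hW : ∀ a ∈ A, ∀ b ∈ B, 0 ≤ W a b) {a : α} (ha : a ∈ A) {b : β} (hb : b ∈ B)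
    (h : outputLaw A p W b = 0) : p a * W a b = 0 :=
  (sum_eq_zero_iff_of_nonneg fun a ha => mul_nonneg (hp a ha) (hW a ha b hb)).1 h a ha

theorem mutualInfo_eq (p : α → ℝ) (hW1 : ∀ a ∈ A, ∑ b ∈ B, W a b = 1) :
    mutualInfo A B (fun a b => p a * W a b) =
      ∑ a ∈ A, p a * relEnt B (W a) (outputLaw A p W) := by
  refine sum_congr rfl fun a ha => ?_
  rw [relEnt, mul_sum]
  refine sum_congr rfl fun b _ => ?_
  rw [← mul_sum, hW1 a ha, mul_one]
  exact mul_logb_mul_div_mul _ _ _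

theorem mutualInfo_nonneg (hp : ∀ a ∈ A, 0 ≤ p a) (hp1 : ∑ a ∈ A, p a = 1)
    (hW : ∀ a ∈ A, ∀ b ∈ B, 0 ≤ W a b) (hW1 : ∀ a ∈ A, ∑ b ∈ B, W a b = 1) :
    0 ≤ mutualInfo A B (fun a b => p a * W a b) := by
  rw [mutualInfo_eq p hW1]
  refine sum_nonneg fun a ha => ?_
  by_cases h : p a = 0
  · rw [h, zero_mul]
  refine mul_nonneg (hp a ha) (relEnt_nonneg _ _ _ (hW a ha) (outputLaw_nonneg hp hW)
    (fun b hb hq => ?_) (hW1 a ha) (sum_outputLaw hp1 hW1))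
  exact (mul_eq_zero.1 (mul_eq_zero_of_outputLaw_eq_zero hp hW ha hb hq)).resolve_left h

/-- Among all reference laws on the output, the output law minimises the mean divergence. -/
theorem mutualInfo_le_sum_relEnt (hp : ∀ a ∈ A, 0 ≤ p a) (hp1 : ∑ a ∈ A, p a = 1)
    (hW : ∀ a ∈ A, ∀ b ∈ B, 0 ≤ W a b) (hW1 : ∀ a ∈ A, ∑ b ∈ B, W a b = 1)
    (r : β → ℝ) (hr : ∀ b ∈ B, 0 ≤ r b) (hr1 : ∑ b ∈ B, r b = 1)
    (hac : ∀ a ∈ A, ∀ b ∈ B, r b = 0 → p a * W a b = 0) :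
    mutualInfo A B (fun a b => p a * W a b) ≤ ∑ a ∈ A, p a * relEnt B (W a) r := by
  rw [mutualInfo_eq p hW1]
  set q := outputLaw A p W with hq
  have hnn : 0 ≤ relEnt B q r :=
    relEnt_nonneg B q r (outputLaw_nonneg hp hW) hr
      (fun b hb h => sum_eq_zero fun a ha => hac a ha b hb h) (sum_outputLaw hp1 hW1) hr1
  have key : ∀ a ∈ A, p a * relEnt B (W a) r =
      p a * relEnt B (W a) q + ∑ b ∈ B, p a * W a b * Real.logb 2 (q b / r b) := by
    intro a ha
    rw [relEnt, relEnt, mul_sum, mul_sum, ← sum_add_distrib]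
    refine sum_congr rfl fun b hb => ?_
    by_cases h : p a * W a b = 0
    · rw [← mul_assoc, ← mul_assoc, h]
      ring
    have hr0 : r b ≠ 0 := fun h' => h (hac a ha b hb h')
    have hq0 : q b ≠ 0 := fun h' => h (mul_eq_zero_of_outputLaw_eq_zero hp hW ha hb h')
    have hW0 : W a b ≠ 0 := right_ne_zero_of_mul h
    rw [Real.logb_div hW0 hr0, Real.logb_div hW0 hq0, Real.logb_div hq0 hr0]
    ring
  rw [sum_congr rfl key, sum_add_distrib, sum_comm (s := A) (t := B)]
  simp only [← sum_mul]
  exact le_add_of_nonneg_right hnn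

theorem mutualInfo_le_logb_card (hB : B.Nonempty) (hp : ∀ a ∈ A, 0 ≤ p a)
    (hp1 : ∑ a ∈ A, p a = 1) (hW : ∀ a ∈ A, ∀ b ∈ B, 0 ≤ W a b)
    (hW1 : ∀ a ∈ A, ∑ b ∈ B, W a b = 1) :
    mutualInfo A B (fun a b => p a * W a b) ≤ Real.logb 2 #B := by
  have hc : (0 : ℝ) < #B := by exact_mod_cast hB.card_pos
  -- The reference law is uniform on `B`.
  refine (mutualInfo_le_sum_relEnt hp hp1 hW hW1 (fun _ => (#B : ℝ)⁻¹) (fun _ _ => by positivity)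
    (by simp [hc.ne']) fun _ _ _ _ h => absurd h (by positivity)).trans ?_
  calc ∑ a ∈ A, p a * relEnt B (W a) (fun _ => (#B : ℝ)⁻¹)
      ≤ ∑ a ∈ A, p a * Real.logb 2 #B := sum_le_sum fun a ha =>
        mul_le_mul_of_nonneg_left ?_ (hp a ha)
    _ = Real.logb 2 #B := by rw [← sum_mul, hp1, one_mul]
  calc relEnt B (W a) (fun _ => (#B : ℝ)⁻¹)
      ≤ ∑ b ∈ B, W a b * Real.logb 2 #B := sum_le_sum fun b hb => ?_
    _ = Real.logb 2 #B := by rw [← sum_mul, hW1 a ha, one_mul]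
  rcases (hW a ha b hb).eq_or_lt with h | h
  · simp [← h]
  refine mul_le_mul_of_nonneg_left (Real.logb_le_logb_of_le (by norm_num) (by positivity) ?_) h.le
  rw [div_inv_eq_mul]
  have hle : W a b ≤ 1 := hW1 a ha ▸ single_le_sum (hW a ha) hb
  exact mul_le_of_le_one_left hc.le hle

/-- Mutual information is convex in the channel. -/
theorem mutualInfo_sum_le {ι : Type*} (s : Finset ι) (w : ι → ℝ) (V : ι → α → β → ℝ)
    (hp : ∀ a ∈ A, 0 ≤ p a) (hw : ∀ i ∈ s, 0 ≤ w i) (hw1 : ∑ i ∈ s, w i = 1)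
    (hV : ∀ i ∈ s, ∀ a ∈ A, ∀ b ∈ B, 0 ≤ V i a b)
    (hV1 : ∀ i ∈ s, ∀ a ∈ A, ∑ b ∈ B, V i a b = 1) :
    mutualInfo A B (fun a b => p a * ∑ i ∈ s, w i * V i a b) ≤
      ∑ i ∈ s, w i * mutualInfo A B (fun a b => p a * V i a b) := by
  have hW1 : ∀ a ∈ A, ∑ b ∈ B, ∑ i ∈ s, w i * V i a b = 1 := fun a ha => by
    rw [sum_comm, ← hw1]
    exact sum_congr rfl fun i hi => by rw [← mul_sum, hV1 i hi a ha, mul_one]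
  have hq : outputLaw A p (fun a b => ∑ i ∈ s, w i * V i a b) =
      fun b => ∑ i ∈ s, w i * outputLaw A p (V i) b := by
    funext b
    simp only [outputLaw, mul_sum]
    rw [sum_comm]
    exact sum_congr rfl fun _ _ => sum_congr rfl fun _ _ => by ring
  rw [mutualInfo_eq p hW1, hq]
  have hrhs : ∑ i ∈ s, w i * mutualInfo A B (fun a b => p a * V i a b) =
      ∑ a ∈ A, p a * ∑ i ∈ s, w i * relEnt B (V i a) (outputLaw A p (V i)) := by
    rw [sum_congr rfl fun i hi => by rw [mutualInfo_eq p (hV1 i hi)]]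
    simp only [mul_sum]
    rw [sum_comm]
    exact sum_congr rfl fun _ _ => sum_congr rfl fun _ _ => by ring
  rw [hrhs]
  refine sum_le_sum fun a ha => ?_
  by_cases h : p a = 0
  · rw [h, zero_mul, zero_mul]
  refine mul_le_mul_of_nonneg_left (relEnt_sum_le s B w (fun i => V i a)
    (fun i => outputLaw A p (V i)) hw (fun i hi => hV i hi a ha)
    (fun i hi => outputLaw_nonneg hp (hV i hi)) fun i hi b hb h' => ?_) (hp a ha)
  exact (mul_eq_zero.1 (mul_eq_zero_of_outputLaw_eq_zero hp (hV i hi) ha hb h')).resolve_left h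

end channel

/-- The law of `f X` when `X` has law `p`. -/
def mapLaw {α γ : Type*} [Fintype α] [DecidableEq γ] (f : α → γ) (p : α → ℝ) (c : γ) : ℝ :=
  ∑ a with f a = c, p a

section mapLaw

variable {α β γ : Type*} [Fintype α] [Fintype γ] [DecidableEq γ] (f : α → γ) (p : α → ℝ)

theorem sum_mapLaw_mul (g : γ → ℝ) : ∑ c, mapLaw f p c * g c = ∑ a, p a * g (f a) := by
  rw [← sum_fiberwise (s := univ) (g := f)]
  refine sum_congr rfl fun c _ => ?_
  rw [mapLaw, sum_mul]
  exact sum_congr rfl fun a ha => by rw [(mem_filter.1 ha).2]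

variable {p} in
theorem mapLaw_mem_stdSimplex (hp : p ∈ stdSimplex ℝ α) : mapLaw f p ∈ stdSimplex ℝ γ := by
  refine ⟨fun c => sum_nonneg fun a _ => hp.1 a, ?_⟩
  have h := sum_mapLaw_mul f p (fun _ => 1)
  simp only [mul_one] at h
  rw [h, hp.2]

theorem outputLaw_mapLaw (W : γ → β → ℝ) :
    outputLaw univ (mapLaw f p) W = outputLaw univ p (fun a => W (f a)) :=
  funext fun b => sum_mapLaw_mul f p fun c => W c b

/-- The divergence of the row at `a` from the output law depends on `a` only through `f a`. -/
theorem mutualInfo_comp (B : Finset β) (W : γ → β → ℝ) (hW1 : ∀ c, ∑ b ∈ B, W c b = 1) :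
    mutualInfo univ B (fun a b => p a * W (f a) b) =
      mutualInfo univ B (fun c b => mapLaw f p c * W c b) := by
  rw [mutualInfo_eq p fun a _ => hW1 (f a), mutualInfo_eq _ fun c _ => hW1 c, sum_mapLaw_mul,
    outputLaw_mapLaw]

end mapLaw

theorem mutualInfo_congr_of_subset {α β : Type*} (A : Finset α) {B B' : Finset β} (hB : B ⊆ B')
    (P : α → β → ℝ) (hP : ∀ a ∈ A, ∀ b ∉ B, P a b = 0) :
    mutualInfo A B' P = mutualInfo A B P := by
  refine sum_congr rfl fun a ha => ?_
  rw [sum_subset hB fun b _ hb => hP a ha b hb]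
  exact (sum_subset hB fun b _ hb => by rw [hP a ha b hb, zero_mul]).symm

/-! ### The deletion channel as an averaging operator -/

/-- The mean of `f Y` when `Y` is the output of the deletion channel for the input word `l`. -/
def outputMean (d : ℝ) : List Bool → (List Bool → ℝ) → ℝ
  | [], f => f []
  | b :: l, f => d * outputMean d l f + (1 - d) * outputMean d l (fun y => f (b :: y))

/-- The probability that exactly the positions marked in `keep` survive. -/
def maskProb (d : ℝ) {n : ℕ} (keep : Fin n → Bool) : ℝ :=
  ∏ i, (if keep i then 1 - d else d)

/-- The word formed by the bits of `x` at the positions marked in `keep`. -/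
def survivors {n : ℕ} (x keep : Fin n → Bool) : List Bool :=
  ((List.finRange n).filter keep).map x

theorem survivors_succ {n : ℕ} (x : Fin (n + 1) → Bool) (c : Bool) (k : Fin n → Bool) :
    survivors x (Fin.cons c k : Fin (n + 1) → Bool) =
      if c then x 0 :: survivors (fun i => x i.succ) k else survivors (fun i => x i.succ) k := by
  unfold survivors
  rw [List.finRange_succ, List.filter_cons, List.filter_map]
  have h : ((Fin.cons c k : Fin (n + 1) → Bool) ∘ Fin.succ) = k := rfl
  rw [h]
  cases c <;> simp [Function.comp_def]

/-- The length counts the kept positions, so the all-`false` word can later stand in for any input.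
-/
theorem length_survivors {n : ℕ} (x x' keep : Fin n → Bool) :
    (survivors x keep).length = (survivors x' keep).length := by
  simp [survivors]

/-- Splitting masks by their first entry reproduces the recursion of `outputMean`; channel
identities can then be proved by induction on the input word. -/
theorem outputMean_ofFn (d : ℝ) {n : ℕ} (x : Fin n → Bool) (f : List Bool → ℝ) :
    outputMean d (List.ofFn x) f = ∑ k : Fin n → Bool, maskProb d k * f (survivors x k) := by
  induction n generalizing f with
  | zero => simp [outputMean, maskProb, survivors]
  | succ n ih =>
    rw [List.ofFn_succ, outputMean, ih, ih, ← (Fin.consEquiv fun _ => Bool).sum_comp,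
      Fintype.sum_prod_type, Fintype.sum_bool, add_comm, mul_sum, mul_sum]
    congr 1 <;> refine sum_congr rfl fun k _ => ?_ <;>
      simp [Fin.consEquiv, survivors_succ, maskProb, Fin.prod_univ_succ, mul_assoc]

theorem transition_eq_outputMean (d : ℝ) (l y : List Bool) :
    transition d l y = outputMean d l (fun z => if z = y then 1 else 0) := by
  conv_rhs => rw [← List.ofFn_get l, outputMean_ofFn]
  refine sum_congr rfl fun k _ => ?_
  rw [mul_ite, mul_one, mul_zero]
  rfl

theorem outputMean_congr (d : ℝ) (l : List Bool) {f g : List Bool → ℝ}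
    (h : ∀ y, y.length ≤ l.length → f y = g y) : outputMean d l f = outputMean d l g := by
  induction l generalizing f g with
  | nil => exact h [] le_rfl
  | cons b l ih =>
    rw [outputMean, outputMean, ih fun y hy => h y (hy.trans (Nat.le_succ _)),
      ih fun y hy => h (b :: y) (Nat.succ_le_succ hy)]

theorem outputMean_const (d : ℝ) (l : List Bool) (c : ℝ) : outputMean d l (fun _ => c) = c := by
  induction l with
  | nil => rfl
  | cons b l ih => rw [outputMean, ih]; ring

theorem outputMean_sum (d : ℝ) (l : List Bool) {ι : Type*} (s : Finset ι)
    (f : ι → List Bool → ℝ) :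
    outputMean d l (fun y => ∑ i ∈ s, f i y) = ∑ i ∈ s, outputMean d l (f i) := by
  induction l generalizing f with
  | nil => rfl
  | cons b l ih =>
    simp only [outputMean, ih (fun i y => f i (b :: y)), ih f, sum_add_distrib, mul_sum]

theorem outputMean_mul_const (d : ℝ) (l : List Bool) (f : List Bool → ℝ) (c : ℝ) :
    outputMean d l (fun y => f y * c) = outputMean d l f * c := by
  induction l generalizing f with
  | nil => rfl
  | cons b l ih =>
    rw [outputMean, outputMean, ih f, ih fun y => f (b :: y)]
    ring

theorem outputMean_nonneg {d : ℝ} (hd : d ∈ Set.Icc (0 : ℝ) 1) (l : List Bool)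
    {f : List Bool → ℝ} (hf : ∀ y, 0 ≤ f y) : 0 ≤ outputMean d l f := by
  induction l generalizing f with
  | nil => exact hf []
  | cons b l ih =>
    exact add_nonneg (mul_nonneg hd.1 (ih hf))
      (mul_nonneg (sub_nonneg.2 hd.2) (ih fun y => hf (b :: y)))

theorem outputMean_append (d : ℝ) (l l' : List Bool) (f : List Bool → ℝ) :
    outputMean d (l ++ l') f = outputMean d l fun y => outputMean d l' fun y' => f (y ++ y') := by
  induction l generalizing f with
  | nil => rfl
  | cons b l ih =>
    rw [List.cons_append, outputMean, outputMean, ih, ih]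
    rfl

theorem outputMean_add (d : ℝ) (l : List Bool) (f g : List Bool → ℝ) :
    outputMean d l (fun y => f y + g y) = outputMean d l f + outputMean d l g := by
  induction l generalizing f g with
  | nil => rfl
  | cons b l ih =>
    rw [outputMean, outputMean, outputMean, ih f g, ih (fun y => f (b :: y)) fun y => g (b :: y)]
    ring

/-- Two deletion channels in series form a deletion channel. -/
theorem outputMean_outputMean (d d' : ℝ) (l : List Bool) (f : List Bool → ℝ) :
    (outputMean d l fun z => outputMean d' z f) = outputMean (d + (1 - d) * d') l f := by
  induction l generalizing f with
  | nil => rfl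
  | cons b l ih =>
    simp only [outputMean]
    rw [outputMean_add]
    -- The constants must stand on the right for `outputMean_mul_const`.
    simp only [mul_comm d', mul_comm (1 - d'), outputMean_mul_const]
    rw [ih, ih]
    ring

theorem outputMean_length (d : ℝ) (l : List Bool) :
    outputMean d l (fun y => (y.length : ℝ)) = (1 - d) * l.length := by
  induction l with
  | nil => simp [outputMean]
  | cons b l ih =>
    simp only [outputMean, List.length_cons, Nat.cast_succ]
    rw [outputMean_add, ih, outputMean_const]
    ring

theorem mem_wordsUpTo {n : ℕ} {y : List Bool} : y ∈ wordsUpTo n ↔ y.length ≤ n := by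
  simp [wordsUpTo]

theorem wordsUpTo_nonempty (n : ℕ) : (wordsUpTo n).Nonempty :=
  ⟨[], mem_wordsUpTo.2 (Nat.zero_le n)⟩

theorem wordsUpTo_mono {m n : ℕ} (h : m ≤ n) : wordsUpTo m ⊆ wordsUpTo n :=
  fun _ hy => mem_wordsUpTo.2 ((mem_wordsUpTo.1 hy).trans h)

theorem sum_transition_mul (d : ℝ) {n : ℕ} {l : List Bool} (hl : l.length ≤ n)
    (f : List Bool → ℝ) :
    ∑ z ∈ wordsUpTo n, transition d l z * f z = outputMean d l f := by
  simp only [transition_eq_outputMean, ← outputMean_mul_const, ← outputMean_sum]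
  refine outputMean_congr d l fun y hy => ?_
  simp [mem_wordsUpTo, hy.trans hl]

theorem sum_transition (d : ℝ) {n : ℕ} {l : List Bool} (hl : l.length ≤ n) :
    ∑ z ∈ wordsUpTo n, transition d l z = 1 := by
  simpa [outputMean_const] using sum_transition_mul d hl fun _ => 1

theorem transition_nonneg {d : ℝ} (hd : d ∈ Set.Icc (0 : ℝ) 1) (l y : List Bool) :
    0 ≤ transition d l y := by
  rw [transition_eq_outputMean]
  exact outputMean_nonneg hd l fun z => by split_ifs <;> norm_num

theorem transition_eq_zero (d : ℝ) {l y : List Bool} (h : l.length < y.length) :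
    transition d l y = 0 := by
  rw [transition_eq_outputMean]
  refine (outputMean_congr d l fun z hz => if_neg ?_).trans (outputMean_const d l 0)
  rintro rfl
  omega

/-- The two halves of the input are deleted independently, and their outputs are concatenated. -/
theorem transition_append (d : ℝ) {m n : ℕ} {l l' : List Bool} (hl : l.length ≤ m)
    (hl' : l'.length ≤ n) (y : List Bool) :
    transition d (l ++ l') y =
      ∑ i ∈ wordsUpTo m ×ˢ wordsUpTo n with i.1 ++ i.2 = y,
        transition d l i.1 * transition d l' i.2 := by
  rw [transition_eq_outputMean, outputMean_append, sum_filter, sum_product,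
    ← sum_transition_mul d hl]
  refine sum_congr rfl fun z _ => ?_
  rw [← sum_transition_mul d hl', mul_sum]
  refine sum_congr rfl fun z' _ => ?_
  split_ifs <;> ring

theorem sum_transition_mul_transition (d d' : ℝ) {n : ℕ} {l : List Bool} (hl : l.length ≤ n)
    (y : List Bool) :
    ∑ z ∈ wordsUpTo n, transition d l z * transition d' z y =
      transition (d + (1 - d) * d') l y := by
  rw [sum_transition_mul d hl, transition_eq_outputMean, ← outputMean_outputMean]
  simp only [transition_eq_outputMean]

theorem maskProb_nonneg {d : ℝ} (hd : d ∈ Set.Icc (0 : ℝ) 1) {n : ℕ} (k : Fin n → Bool) :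
    0 ≤ maskProb d k :=
  prod_nonneg fun i _ => by split_ifs <;> linarith [hd.1, hd.2]

theorem sum_maskProb (d : ℝ) (n : ℕ) : ∑ k : Fin n → Bool, maskProb d k = 1 := by
  simpa [outputMean_const] using (outputMean_ofFn d (fun _ : Fin n => false) fun _ => 1).symm

theorem sum_maskProb_mul_length (d : ℝ) {n : ℕ} (x : Fin n → Bool) :
    ∑ k : Fin n → Bool, maskProb d k * (survivors x k).length = (1 - d) * n := by
  rw [← outputMean_ofFn d x fun y => (y.length : ℝ), outputMean_length, List.length_ofFn]

/-! ### The maximal block information -/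

section block

variable {d : ℝ} {n : ℕ} {p : (Fin n → Bool) → ℝ}

theorem sum_transition_ofFn (d : ℝ) {n : ℕ} (x : Fin n → Bool) :
    ∑ y ∈ wordsUpTo n, transition d (List.ofFn x) y = 1 :=
  sum_transition d (List.length_ofFn).le

theorem blockInfo_nonneg (hd : d ∈ Set.Icc (0 : ℝ) 1) (hp : p ∈ stdSimplex ℝ (Fin n → Bool)) :
    0 ≤ blockInfo d n p :=
  mutualInfo_nonneg (fun x _ => hp.1 x) hp.2 (fun _ _ _ _ => transition_nonneg hd _ _)
    fun x _ => sum_transition_ofFn d x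

theorem bddAbove_blockInfo (hd : d ∈ Set.Icc (0 : ℝ) 1) (n : ℕ) :
    BddAbove (blockInfo d n '' stdSimplex ℝ (Fin n → Bool)) := by
  refine ⟨Real.logb 2 #(wordsUpTo n), ?_⟩
  rintro _ ⟨p, hp, rfl⟩
  exact mutualInfo_le_logb_card (wordsUpTo_nonempty n) (fun x _ => hp.1 x) hp.2
    (fun _ _ _ _ => transition_nonneg hd _ _) fun x _ => sum_transition_ofFn d x

theorem blockInfo_le_maxInfo (hd : d ∈ Set.Icc (0 : ℝ) 1)
    (hp : p ∈ stdSimplex ℝ (Fin n → Bool)) : blockInfo d n p ≤ maxInfo d n :=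
  le_csSup (bddAbove_blockInfo hd n) ⟨p, hp, rfl⟩

theorem maxInfo_nonneg (hd : d ∈ Set.Icc (0 : ℝ) 1) (n : ℕ) : 0 ≤ maxInfo d n := by
  refine Real.sSup_nonneg ?_
  rintro _ ⟨p, hp, rfl⟩
  exact blockInfo_nonneg hd hp

theorem maxInfo_le {c : ℝ} (h : ∀ p ∈ stdSimplex ℝ (Fin n → Bool), blockInfo d n p ≤ c) :
    maxInfo d n ≤ c := by
  refine csSup_le (Set.Nonempty.image _ ⟨_, single_mem_stdSimplex ℝ (fun _ => false)⟩) ?_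
  rintro _ ⟨p, hp, rfl⟩
  exact h p hp

theorem blockInfo_eq (d : ℝ) {n : ℕ} (p : (Fin n → Bool) → ℝ) :
    blockInfo d n p = ∑ x, p x * relEnt (wordsUpTo n) (transition d (List.ofFn x))
      (outputLaw univ p fun x => transition d (List.ofFn x)) :=
  mutualInfo_eq p fun x _ => sum_transition_ofFn d x

end block

/-! ### Subadditivity and existence of the limit -/

theorem maxInfo_add_le {d : ℝ} (hd : d ∈ Set.Icc (0 : ℝ) 1) (m n : ℕ) :
    maxInfo d (m + n) ≤ maxInfo d m + maxInfo d n := by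
  refine maxInfo_le fun p hp => ?_
  let l : (Fin (m + n) → Bool) → Fin m → Bool := fun x i => x (Fin.castAdd n i)
  let r : (Fin (m + n) → Bool) → Fin n → Bool := fun x i => x (Fin.natAdd m i)
  have hx : ∀ x, List.ofFn x = List.ofFn (l x) ++ List.ofFn (r x) := fun x => List.ofFn_add
  have hpl := mapLaw_mem_stdSimplex l hp
  have hpr := mapLaw_mem_stdSimplex r hp
  set q := outputLaw univ p fun x => transition d (List.ofFn (l x)) with hq
  set q' := outputLaw univ p fun x => transition d (List.ofFn (r x)) with hq'
  have hql : outputLaw univ (mapLaw l p) (fun x => transition d (List.ofFn x)) = q :=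
    outputLaw_mapLaw l p _
  have hqr : outputLaw univ (mapLaw r p) (fun x => transition d (List.ofFn x)) = q' :=
    outputLaw_mapLaw r p _
  have hT : ∀ l y, 0 ≤ transition d l y := transition_nonneg hd
  have hq0 : ∀ y, 0 ≤ q y := fun y => sum_nonneg fun x _ => mul_nonneg (hp.1 x) (hT _ _)
  have hq0' : ∀ y, 0 ≤ q' y := fun y => sum_nonneg fun x _ => mul_nonneg (hp.1 x) (hT _ _)
  -- The output set `{y}` makes the support lemma available at every word `y`.
  have hac : ∀ x, p x ≠ 0 → ∀ y, q y = 0 → transition d (List.ofFn (l x)) y = 0 :=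
    fun x hpx y h => (mul_eq_zero.1 (mul_eq_zero_of_outputLaw_eq_zero (B := {y})
      (fun x _ => hp.1 x) (fun _ _ _ _ => hT _ _) (mem_univ x) (mem_singleton_self y)
      h)).resolve_left hpx
  have hac' : ∀ x, p x ≠ 0 → ∀ y, q' y = 0 → transition d (List.ofFn (r x)) y = 0 :=
    fun x hpx y h => (mul_eq_zero.1 (mul_eq_zero_of_outputLaw_eq_zero (B := {y})
      (fun x _ => hp.1 x) (fun _ _ _ _ => hT _ _) (mem_univ x) (mem_singleton_self y)
      h)).resolve_left hpx
  have happ : ∀ i ∈ wordsUpTo m ×ˢ wordsUpTo n, i.1 ++ i.2 ∈ wordsUpTo (m + n) := by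
    intro i hi
    have h := mem_product.1 hi
    rw [mem_wordsUpTo, List.length_append]
    exact add_le_add (mem_wordsUpTo.1 h.1) (mem_wordsUpTo.1 h.2)
  have hTapp : ∀ x, transition d (List.ofFn x) = fun y =>
      ∑ i ∈ wordsUpTo m ×ˢ wordsUpTo n with i.1 ++ i.2 = y,
        transition d (List.ofFn (l x)) i.1 * transition d (List.ofFn (r x)) i.2 := fun x =>
    funext fun y => by rw [hx x, transition_append d List.length_ofFn.le List.length_ofFn.le]
  -- Reference law: the concatenation of independent outputs with the two block marginals.
  -- Divergence from it is at most a divergence of product laws, which splits.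
  set ρ : List Bool → ℝ := fun y =>
    ∑ i ∈ wordsUpTo m ×ˢ wordsUpTo n with i.1 ++ i.2 = y, q i.1 * q' i.2 with hρ
  have hρ1 : ∑ y ∈ wordsUpTo (m + n), ρ y = 1 := by
    rw [hρ, sum_fiberwise_of_maps_to happ fun i => q i.1 * q' i.2, sum_product]
    simp only [← mul_sum]
    rw [sum_outputLaw hp.2 fun x _ => sum_transition_ofFn d (r x)]
    simp only [mul_one]
    exact sum_outputLaw hp.2 fun x _ => sum_transition_ofFn d (l x)
  have hprod : ∀ x, p x ≠ 0 → ∀ i : List Bool × List Bool, q i.1 * q' i.2 = 0 →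
      transition d (List.ofFn (l x)) i.1 * transition d (List.ofFn (r x)) i.2 = 0 := by
    intro x hpx i h
    rcases mul_eq_zero.1 h with h | h
    · rw [hac x hpx _ h, zero_mul]
    · rw [hac' x hpx _ h, mul_zero]
  calc blockInfo d (m + n) p
      ≤ ∑ x, p x * relEnt (wordsUpTo (m + n)) (transition d (List.ofFn x)) ρ := by
        refine mutualInfo_le_sum_relEnt (fun x _ => hp.1 x) hp.2 (fun _ _ _ _ => hT _ _)
          (fun x _ => sum_transition_ofFn d x) ρ
          (fun y _ => sum_nonneg fun i _ => mul_nonneg (hq0 _) (hq0' _)) hρ1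
          fun x _ y _ h => ?_
        by_cases hpx : p x = 0
        · rw [hpx, zero_mul]
        have hz := (sum_eq_zero_iff_of_nonneg
          fun (i : List Bool × List Bool) _ => mul_nonneg (hq0 i.1) (hq0' i.2)).1 h
        rw [hTapp x]
        exact mul_eq_zero_of_right _ (sum_eq_zero fun i hi => hprod x hpx i (hz i hi))
    _ ≤ ∑ x, p x * (relEnt (wordsUpTo m) (transition d (List.ofFn (l x))) q +
          relEnt (wordsUpTo n) (transition d (List.ofFn (r x))) q') := by
        refine sum_le_sum fun x _ => ?_
        by_cases hpx : p x = 0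
        · rw [hpx, zero_mul, zero_mul]
        refine mul_le_mul_of_nonneg_left ?_ (hp.1 x)
        rw [← relEnt_prod _ _ _ _ _ _ (sum_transition_ofFn d _) (sum_transition_ofFn d _)
          (fun y _ => hac x hpx y) fun y _ => hac' x hpx y, hTapp x]
        exact relEnt_map_le _ _ (fun i : List Bool × List Bool => i.1 ++ i.2) happ _ _
          (fun i _ => mul_nonneg (hT _ _) (hT _ _)) (fun i _ => mul_nonneg (hq0 _) (hq0' _))
          fun i _ => hprod x hpx i
    _ = blockInfo d m (mapLaw l p) + blockInfo d n (mapLaw r p) := by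
        rw [blockInfo_eq, blockInfo_eq, hql, hqr,
          sum_mapLaw_mul l p fun z => relEnt (wordsUpTo m) (transition d (List.ofFn z)) q,
          sum_mapLaw_mul r p fun z => relEnt (wordsUpTo n) (transition d (List.ofFn z)) q',
          ← sum_add_distrib]
        simp only [mul_add]
    _ ≤ maxInfo d m + maxInfo d n :=
        add_le_add (blockInfo_le_maxInfo hd hpl) (blockInfo_le_maxInfo hd hpr)

theorem tendsto_maxInfo_div {d : ℝ} (hd : d ∈ Set.Icc (0 : ℝ) 1) :
    Tendsto (fun n : ℕ => maxInfo d n / n) atTop (𝓝 (capacity d)) := by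
  have hsub : Subadditive (maxInfo d) := maxInfo_add_le hd
  have h := hsub.tendsto_lim ⟨0, by
    rintro _ ⟨n, rfl⟩
    exact div_nonneg (maxInfo_nonneg hd n) n.cast_nonneg⟩
  rwa [capacity, h.limsup_eq]

/-! ### The capacity bound -/

/-- Revealing the deletion pattern of the first of two channels in series bounds the block
information by an average over shorter blocks. -/
theorem maxInfo_comp_le {d d' : ℝ} (hd : d ∈ Set.Icc (0 : ℝ) 1) (hd' : d' ∈ Set.Icc (0 : ℝ) 1)
    (n : ℕ) :
    maxInfo (d + (1 - d) * d') n ≤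
      ∑ k : Fin n → Bool, maskProb d k * maxInfo d' (survivors (fun _ => false) k).length := by
  refine maxInfo_le fun p hp => ?_
  have hlen : ∀ x k : Fin n → Bool, (survivors x k).length ≤ n := fun x k => by
    rw [survivors, List.length_map]
    exact (List.length_filter_le _ _).trans List.length_finRange.le
  have hW : ∀ (x : Fin n → Bool) y, transition (d + (1 - d) * d') (List.ofFn x) y =
      ∑ k, maskProb d k * transition d' (survivors x k) y := fun x y => by
    rw [← outputMean_ofFn d x fun z => transition d' z y,
      ← sum_transition_mul_transition d d' List.length_ofFn.le,
      sum_transition_mul d List.length_ofFn.le]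
  simp only [blockInfo, hW]
  refine (mutualInfo_sum_le univ (maskProb d) (fun k x => transition d' (survivors x k))
    (fun x _ => hp.1 x) (fun k _ => maskProb_nonneg hd k) (sum_maskProb d n)
    (fun _ _ _ _ _ _ => transition_nonneg hd' _ _)
    fun k _ x _ => sum_transition d' (hlen x k)).trans ?_
  refine sum_le_sum fun k _ => mul_le_mul_of_nonneg_left ?_ (maskProb_nonneg hd k)
  set m := (survivors (fun _ => false) k).length with hm
  have hmn : m ≤ n := hlen _ k
  -- For fixed `k` the surviving bits form a block of fixed length `m`, whose law is an admissible
  -- input law.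
  let f : (Fin n → Bool) → Fin m → Bool := fun x i =>
    (survivors x k).get (i.cast (length_survivors _ x k))
  have hf : ∀ x, List.ofFn (f x) = survivors x k := fun x => by
    refine List.ext_getElem (by rw [List.length_ofFn, hm, length_survivors]) fun i _ _ => ?_
    simp [f]
  refine le_trans (le_of_eq ?_) (blockInfo_le_maxInfo hd' (mapLaw_mem_stdSimplex f hp))
  rw [blockInfo, ← mutualInfo_comp f p (wordsUpTo m) (fun z => transition d' (List.ofFn z))
    fun z => sum_transition_ofFn d' z]
  simp only [hf]
  refine mutualInfo_congr_of_subset _ (wordsUpTo_mono hmn) _ fun x _ y hy => ?_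
  rw [transition_eq_zero, mul_zero]
  rw [length_survivors x (fun _ => false), ← hm]
  exact not_le.1 (mt mem_wordsUpTo.2 hy)

/-- The number of survivors is random and may be small, so an asymptotic rate is not enough: the
bound must hold at every length and be affine, to pass through the mean. -/
theorem exists_maxInfo_le {d c : ℝ} (hd : d ∈ Set.Icc (0 : ℝ) 1) (hc : capacity d < c) :
    ∃ a : ℝ, ∀ n : ℕ, maxInfo d n ≤ c * n + a := by
  obtain ⟨N, hN⟩ := eventually_atTop.1 ((tendsto_maxInfo_div hd).eventually_lt_const hc)
  have hc0 : 0 ≤ c := le_trans (ge_of_tendsto' (tendsto_maxInfo_div hd) fun n =>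
    div_nonneg (maxInfo_nonneg hd n) n.cast_nonneg) hc.le
  have ha : 0 ≤ ∑ k ∈ range (N + 1), maxInfo d k := sum_nonneg fun k _ => maxInfo_nonneg hd k
  -- This sum of nonnegative terms dominates each of the lengths up to `N`, including 0.
  refine ⟨∑ k ∈ range (N + 1), maxInfo d k, fun n => ?_⟩
  rcases le_or_gt n N with h | h
  · have h1 := single_le_sum (f := maxInfo d) (fun k _ => maxInfo_nonneg hd k)
      (mem_range.2 (Nat.lt_succ_of_le h))
    have h2 : 0 ≤ c * n := by positivity
    linarith
  · have hn : (0 : ℝ) < n := by exact_mod_cast (Nat.zero_le N).trans_lt h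
    have h1 := (div_lt_iff₀ hn).1 (hN n h.le)
    linarith

theorem capacity_comp_le {d d' : ℝ} (hd : d ∈ Set.Icc (0 : ℝ) 1)
    (hd' : d' ∈ Set.Icc (0 : ℝ) 1) :
    capacity (d + (1 - d) * d') ≤ (1 - d) * capacity d' := by
  have hdd : d + (1 - d) * d' ∈ Set.Icc (0 : ℝ) 1 := by
    have h := sub_nonneg.2 hd.2
    exact ⟨add_nonneg hd.1 (mul_nonneg h hd'.1), by nlinarith [hd'.2]⟩
  have key : ∀ c, capacity d' < c → capacity (d + (1 - d) * d') ≤ (1 - d) * c := by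
    intro c hc
    obtain ⟨a, ha⟩ := exists_maxInfo_le hd' hc
    have hlim : Tendsto (fun n : ℕ => (1 - d) * c + a / n) atTop (𝓝 ((1 - d) * c)) := by
      simpa using (tendsto_const_div_atTop_nhds_zero_nat a).const_add ((1 - d) * c)
    refine le_of_tendsto_of_tendsto (tendsto_maxInfo_div hdd) hlim ?_
    filter_upwards [eventually_gt_atTop 0] with n hn
    have hn' : (0 : ℝ) < n := by exact_mod_cast hn
    rw [div_le_iff₀ hn', add_mul, div_mul_cancel₀ _ hn'.ne']
    calc maxInfo (d + (1 - d) * d') n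
        ≤ ∑ k : Fin n → Bool,
            maskProb d k * maxInfo d' (survivors (fun _ => false) k).length :=
          maxInfo_comp_le hd hd' n
      _ ≤ ∑ k : Fin n → Bool,
            maskProb d k * (c * (survivors (fun _ => false) k).length + a) :=
          sum_le_sum fun k _ => mul_le_mul_of_nonneg_left (ha _) (maskProb_nonneg hd k)
      _ = c * ∑ k : Fin n → Bool, maskProb d k * (survivors (fun _ => false) k).length +
            (∑ k : Fin n → Bool, maskProb d k) * a := by
          rw [mul_sum, sum_mul, ← sum_add_distrib]
          exact sum_congr rfl fun _ _ => by ring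
      _ = (1 - d) * c * n + a := by
          rw [sum_maskProb_mul_length, sum_maskProb]
          ring
  -- The bound holds for each c above the capacity; let c decrease to it.
  have hlim : Tendsto (fun c => (1 - d) * c) (𝓝[>] capacity d') (𝓝 ((1 - d) * capacity d')) :=
    ((continuous_const_mul (1 - d)).tendsto _).mono_left nhdsWithin_le_nhds
  exact ge_of_tendsto hlim (eventually_nhdsWithin_of_forall key)

end DeletionChannel

end

theorem mainTheorem2 (lam d₁ : ℝ) (hlam : lam ∈ Set.Icc (0 : ℝ) 1)
    (hd₁ : d₁ ∈ Set.Icc (0 : ℝ) 1) :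
    (∀ d ∈ Set.Icc (0 : ℝ) 1,
      Tendsto (fun n : ℕ => DeletionChannel.maxInfo d n / n) atTop
        (𝓝 (DeletionChannel.capacity d))) ∧
    (∀ x y : List Bool,
      ∑ z ∈ DeletionChannel.wordsUpTo x.length,
          DeletionChannel.transition (1 - lam) x z * DeletionChannel.transition d₁ z y =
        DeletionChannel.transition (lam * d₁ + 1 - lam) x y) ∧
    DeletionChannel.capacity (lam * d₁ + 1 - lam) ≤ lam * DeletionChannel.capacity d₁ := by
  have hd : 1 - lam ∈ Set.Icc (0 : ℝ) 1 := ⟨by linarith [hlam.2], by linarith [hlam.1]⟩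
  have heq : lam * d₁ + 1 - lam = 1 - lam + (1 - (1 - lam)) * d₁ := by ring
  refine ⟨fun d hd => DeletionChannel.tendsto_maxInfo_div hd, fun x y => ?_, ?_⟩
  · rw [heq]
    exact DeletionChannel.sum_transition_mul_transition _ _ le_rfl y
  · rw [heq]
    simpa using DeletionChannel.capacity_comp_le hd hd₁
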